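/- Let $I$ be a set and let $P$ be a countable Köthe set on $I$, i.e. a countable set of functions $p=(p_i)_{i\in I}\colon I\to[0,\infty)$ such that (P1) for each $i\in I$ there is $p\in P$ with $p_i>0$, and (P2) for all $p,q\in P$ there is $r\in P$ with $\max\{p_i,q_i\}\le r_i$ for all $i\in I$. Let $$\lambda(P)=\Bigl\{x=(x_i)\in\mathbb C^I:\ \|x\|_p=\sum_{i\in I}|x_i|p_i<\infty\ \text{ for all } p\in P\Bigr\},$$ with the topology given by the seminorms $\|\cdot\|_p$ $(p\in P)$. For Köthe sets $P,Q$ write $P\prec Q$ if for each $p\in P$ there are $q\in Q$ and $C>0$ with $p_i\le Cq_i$ for all $i$; write $P\sim Q$ if $P\prec Q$ and $Q\prec P$; and let $P^2=\{(p_iq_i)_{i\in I}: p,q\in P\}$. Assume that $P\prec P^2$, so that $A=\lambda(P)$ is a Fréchet algebra under pointwise multiplication (a Köthe algebra). Suppose that $P$ satisfies * (B) $P\sim P^2$, and * (N) for each $p\in P$ there are $q\in P$ and $\alpha\in\ell^1(I)$ with $p_i\le\alpha_iq_i$ for all $i\in I$. Then $A$ is approximately contractible: for every Fréchet $A$-bimodule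 $X$ (a Fréchet space with commuting, associative, bilinear, jointly continuous left and right actions of $A$) and every continuous linear map $D\colon A\to X$ with $D(ab)=a\cdot D(b)+D(a)\cdot b$ for all $a,b\in A$, there is a net $(x_\nu)$ in $X$ such that $D(a)=\lim_\nu\,(a\cdot x_\nu-x_\nu\cdot a)$ for every $a\in A$. -/

import Mathlib

open Filter Topology

universe u v

/-! ### Fréchet spaces, Fréchet algebras, Fréchet bimodules -/

/-- A complex Fréchet space: a complete metrizable locally convex space. -/
class IsFrechetSpace (E : Type u) [AddCommGroup E] [Module ℂ E] [UniformSpace E] : Prop extends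
    IsUniformAddGroup E, ContinuousSMul ℂ E, LocallyConvexSpace ℝ E,
    TopologicalSpace.MetrizableSpace E, CompleteSpace E

/-- A (not necessarily unital, not necessarily locally `m`-convex) complex Fréchet algebra: an
associative algebra on a Fréchet space, with jointly continuous multiplication. -/
class IsFrechetAlgebra (A : Type u) [NonUnitalRing A] [Module ℂ A] [IsScalarTower ℂ A A]
    [SMulCommClass ℂ A A] [UniformSpace A] : Prop extends IsFrechetSpace A, ContinuousMul A

section Bimodules

variable (A : Type u) [NonUnitalRing A] [Module ℂ A] [IsScalarTower ℂ A A] [SMulCommClass ℂ A A]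
  [UniformSpace A] [IsFrechetAlgebra A]
variable (X : Type v) [AddCommGroup X] [Module ℂ X] [UniformSpace X] [IsFrechetSpace X]

/-- The structure of a Fréchet `A`-bimodule on the Fréchet space `X`: two commuting jointly
continuous bilinear actions of `A`. Here `left a x` is `a · x` and `right a x` is `x · a`. -/
structure FrechetBimodule where
  left : A →ₗ[ℂ] X →ₗ[ℂ] X
  right : A →ₗ[ℂ] X →ₗ[ℂ] X
  left_mul : ∀ (a b : A) (x : X), left (a * b) x = left a (left b x)
  right_mul : ∀ (a b : A) (x : X), right (a * b) x = right b (right a x)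
  left_right : ∀ (a b : A) (x : X), right b (left a x) = left a (right b x)
  continuous_left : Continuous fun z : A × X => left z.1 z.2
  continuous_right : Continuous fun z : A × X => right z.1 z.2

variable {A X}

/-- `D : A → X` is a derivation: `D (a b) = a · D b + D a · b`. -/
def FrechetBimodule.IsDerivation (M : FrechetBimodule A X) (D : A →ₗ[ℂ] X) : Prop :=
  ∀ a b : A, D (a * b) = M.left a (D b) + M.right b (D a)

/-- `D : A → X` is an inner derivation: for some `x : X`, `D a = a · x - x · a` for all `a`. -/
def FrechetBimodule.IsInner (M : FrechetBimodule A X) (D : A →ₗ[ℂ] X) : Prop :=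
  ∃ x : X, ∀ a : A, D a = M.left a x - M.right a x

end Bimodules

/-- A Fréchet algebra `A` is approximately contractible if for each Fréchet `A`-bimodule `X`, every
continuous derivation `A → X` is the limit of a pointwise convergent net of inner derivations. -/
def IsApproximatelyContractible (A : Type u) [NonUnitalRing A] [Module ℂ A] [IsScalarTower ℂ A A]
    [SMulCommClass ℂ A A] [UniformSpace A] [IsFrechetAlgebra A] : Prop :=
  ∀ (X : Type v) [AddCommGroup X] [Module ℂ X] [UniformSpace X] [IsFrechetSpace X]
    (M : FrechetBimodule A X) (D : A →ₗ[ℂ] X), Continuous D → M.IsDerivation D →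
    ∃ (Λ : Type u) (_ : Preorder Λ) (_ : IsDirectedOrder Λ) (_ : Nonempty Λ)
      (δ : Λ → A →ₗ[ℂ] X), (∀ l, M.IsInner (δ l)) ∧
        ∀ a : A, Tendsto (fun l => δ l a) atTop (𝓝 (D a))

/-! ### Köthe sets -/

/-- A countable Köthe set on `I`. -/
structure KotheSet (I : Type u) where
  carrier : Set (I → ℝ)
  countable : carrier.Countable
  nonneg : ∀ p ∈ carrier, ∀ i, 0 ≤ p i
  exists_pos : ∀ i, ∃ p ∈ carrier, 0 < p i
  directed : ∀ p ∈ carrier, ∀ q ∈ carrier, ∃ r ∈ carrier, ∀ i, max (p i) (q i) ≤ r i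

namespace KotheSet

variable {I : Type u}

/-- `P ≺ Q`: the Köthe set `P` is dominated by `Q`. -/
def Dominated (P Q : KotheSet I) : Prop :=
  ∀ p ∈ P.carrier, ∃ q ∈ Q.carrier, ∃ C : ℝ, 0 < C ∧ ∀ i, p i ≤ C * q i

/-- `P ∼ Q`: the Köthe sets `P` and `Q` are equivalent. -/
def Equivalent (P Q : KotheSet I) : Prop := P.Dominated Q ∧ Q.Dominated P

/-- The product `P · Q = {p q : p ∈ P, q ∈ Q}` of two Köthe sets. -/
def prod (P Q : KotheSet I) : KotheSet I where
  carrier := Set.image2 (fun p q i => p i * q i) P.carrier Q.carrier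
  countable := P.countable.image2 Q.countable _
  nonneg := by
    rintro _ ⟨p, hp, q, hq, rfl⟩ i
    exact mul_nonneg (P.nonneg p hp i) (Q.nonneg q hq i)
  exists_pos := by
    intro i
    obtain ⟨p, hp, hpi⟩ := P.exists_pos i
    obtain ⟨q, hq, hqi⟩ := Q.exists_pos i
    exact ⟨_, ⟨p, hp, q, hq, rfl⟩, mul_pos hpi hqi⟩
  directed := by
    rintro _ ⟨p, hp, q, hq, rfl⟩ _ ⟨p', hp', q', hq', rfl⟩
    obtain ⟨r, hr, hpr⟩ := P.directed p hp p' hp'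
    obtain ⟨s, hs, hqs⟩ := Q.directed q hq q' hq'
    refine ⟨_, ⟨r, hr, s, hs, rfl⟩, fun i => max_le ?_ ?_⟩
    · exact mul_le_mul ((le_max_left _ _).trans (hpr i)) ((le_max_left _ _).trans (hqs i))
        (Q.nonneg q hq i) (P.nonneg r hr i)
    · exact mul_le_mul ((le_max_right _ _).trans (hpr i)) ((le_max_right _ _).trans (hqs i))
        (Q.nonneg q' hq' i) (P.nonneg r hr i)

/-- `P` satisfies condition (B): `P ∼ P²`. -/
def CondB (P : KotheSet I) : Prop := P.Equivalent (P.prod P)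

/-- `P` satisfies condition (N): for each `p ∈ P` there are `q ∈ P` and `α ∈ ℓ¹(I)` with
`p ≤ α q`. -/
def CondN (P : KotheSet I) : Prop :=
  ∀ p ∈ P.carrier, ∃ q ∈ P.carrier, ∃ α : I → ℝ, Summable α ∧ ∀ i, p i ≤ α i * q i

/-- The Köthe space `λ(P)`, as a vector space: all `x : I → ℂ` with `∑ |xᵢ| pᵢ < ∞` for all
`p ∈ P`. -/
def space (P : KotheSet I) : Submodule ℂ (I → ℂ) where
  carrier := {x | ∀ p ∈ P.carrier, Summable fun i => ‖x i‖ * p i}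
  zero_mem' := by
    intro p _
    simp [summable_zero]
  add_mem' := by
    intro x y hx hy p hp
    refine Summable.of_nonneg_of_le (fun i => mul_nonneg (norm_nonneg _) (P.nonneg p hp i))
      (fun i => ?_) ((hx p hp).add (hy p hp))
    rw [← add_mul]
    exact mul_le_mul_of_nonneg_right (norm_add_le _ _) (P.nonneg p hp i)
  smul_mem' := by
    intro c x hx p hp
    simpa [mul_assoc] using (hx p hp).mul_left ‖c‖

/-- If `P ≺ P²`, then `λ(P)` is closed under pointwise multiplication. -/
theorem mul_mem_space (P : KotheSet I) (hP : P.Dominated (P.prod P)) {x y : I → ℂ}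
    (hx : x ∈ P.space) (hy : y ∈ P.space) : x * y ∈ P.space := by
  intro p hp
  obtain ⟨_, ⟨q, hq, r, hr, rfl⟩, C, hC, h⟩ := hP p hp
  have hs : Summable fun i => C * (‖x i‖ * q i * ∑' j, ‖y j‖ * r j) :=
    ((hx q hq).mul_right _).mul_left C
  refine Summable.of_nonneg_of_le (fun i => mul_nonneg (norm_nonneg _) (P.nonneg p hp i))
    (fun i => ?_) hs
  have h1 : ‖y i‖ * r i ≤ ∑' j, ‖y j‖ * r j :=
    (hy r hr).le_tsum i fun j _ => mul_nonneg (norm_nonneg _) (P.nonneg r hr j)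
  calc ‖(x * y) i‖ * p i ≤ ‖x i‖ * ‖y i‖ * (C * (q i * r i)) := by
        rw [Pi.mul_apply, norm_mul]
        exact mul_le_mul_of_nonneg_left (h i) (by positivity)
    _ = C * (‖x i‖ * q i * (‖y i‖ * r i)) := by ring
    _ ≤ _ := mul_le_mul_of_nonneg_left
        (mul_le_mul_of_nonneg_left h1 (mul_nonneg (norm_nonneg _) (P.nonneg q hq i))) hC.le

/-- If `P ≺ P²`, the Köthe space `λ(P)` as a subalgebra of `ℂ^I` under pointwise multiplication. -/
def subalgebra (P : KotheSet I) (hP : P.Dominated (P.prod P)) : NonUnitalSubalgebra ℂ (I → ℂ) where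
  carrier := P.space
  zero_mem' := P.space.zero_mem
  add_mem' := P.space.add_mem
  smul_mem' := fun c _ hx => P.space.smul_mem c hx
  mul_mem' := P.mul_mem_space hP

end KotheSet

/-! ### Köthe algebras -/

/-- The Köthe algebra `λ(P)`, for a Köthe set with `P ≺ P²`. This is a type synonym of
`P.subalgebra hP`; it carries the topology given by the seminorms `‖·‖_p`, `p ∈ P`, and not the
topology of pointwise convergence. -/
def KotheAlgebra {I : Type u} (P : KotheSet I) (hP : P.Dominated (P.prod P)) : Type u :=
  P.subalgebra hP

namespace KotheAlgebra

variable {I : Type u} {P : KotheSet I} {hP : P.Dominated (P.prod P)}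

instance : NonUnitalCommRing (KotheAlgebra P hP) :=
  inferInstanceAs (NonUnitalCommRing (P.subalgebra hP))

instance : Module ℂ (KotheAlgebra P hP) :=
  inferInstanceAs (Module ℂ (P.subalgebra hP))

instance : IsScalarTower ℂ (KotheAlgebra P hP) (KotheAlgebra P hP) :=
  inferInstanceAs (IsScalarTower ℂ (P.subalgebra hP) (P.subalgebra hP))

instance : SMulCommClass ℂ (KotheAlgebra P hP) (KotheAlgebra P hP) :=
  inferInstanceAs (SMulCommClass ℂ (P.subalgebra hP) (P.subalgebra hP))

/-- The coordinates of an element of `λ(P)`. -/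
def coord (x : KotheAlgebra P hP) : I → ℂ := x.1

theorem summable (x : KotheAlgebra P hP) (p : P.carrier) :
    Summable fun i => ‖x.coord i‖ * p.1 i := x.2 p.1 p.2

/-- The seminorm `‖x‖_p = ∑ |xᵢ| pᵢ` on `λ(P)`. -/
noncomputable def seminorm (P : KotheSet I) (hP : P.Dominated (P.prod P)) (p : P.carrier) :
    Seminorm ℂ (KotheAlgebra P hP) :=
  Seminorm.of (fun x => ∑' i, ‖x.coord i‖ * p.1 i)
    (by
      intro x y
      rw [← (x.summable p).tsum_add (y.summable p)]
      refine (summable (x + y) p).tsum_le_tsum (fun i => ?_)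
        ((x.summable p).add (y.summable p))
      rw [← add_mul]
      exact mul_le_mul_of_nonneg_right (norm_add_le _ _) (P.nonneg _ p.2 i))
    (by
      intro c x
      rw [← tsum_mul_left]
      refine tsum_congr fun i => ?_
      have : (c • x).coord i = c * x.coord i := rfl
      rw [this, norm_mul, mul_assoc])

/-- The uniform structure (hence the topology) of `λ(P)`, generated by the seminorms `‖·‖_p`,
`p ∈ P`. -/
noncomputable instance : UniformSpace (KotheAlgebra P hP) :=
  ⨅ p : P.carrier, (seminorm P hP p).toSeminormedAddCommGroup.toUniformSpace

instance : IsUniformAddGroup (KotheAlgebra P hP) :=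
  isUniformAddGroup_iInf fun p =>
    letI := (seminorm P hP p).toSeminormedAddCommGroup
    inferInstance

theorem withSeminorms : WithSeminorms (seminorm P hP) :=
  (SeminormFamily.withSeminorms_iff_uniformSpace_eq_iInf _).mpr rfl

theorem norm_coord_mul_le (x : KotheAlgebra P hP) (p : P.carrier) (i : I) :
    ‖x.coord i‖ * p.1 i ≤ seminorm P hP p x :=
  (x.summable p).le_tsum i fun j _ => mul_nonneg (norm_nonneg _) (P.nonneg _ p.2 j)

theorem exists_seminorm_mul_le (p : P.carrier) : ∃ (q r : P.carrier) (C : ℝ),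
    ∀ x y : KotheAlgebra P hP,
      seminorm P hP p (x * y) ≤ C * (seminorm P hP q x * seminorm P hP r y) := by
  obtain ⟨_, ⟨q, hq, r, hr, rfl⟩, C, hC, h⟩ := hP p.1 p.2
  refine ⟨⟨q, hq⟩, ⟨r, hr⟩, C, fun x y => ?_⟩
  have hs : HasSum (fun i => C * (‖x.coord i‖ * q i * seminorm P hP ⟨r, hr⟩ y))
      (C * (seminorm P hP ⟨q, hq⟩ x * seminorm P hP ⟨r, hr⟩ y)) :=
    ((x.summable ⟨q, hq⟩).hasSum.mul_right _).mul_left C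
  refine hasSum_le (fun i => ?_) (summable (x * y) p).hasSum hs
  have h1 := norm_coord_mul_le y ⟨r, hr⟩ i
  calc ‖(x * y).coord i‖ * p.1 i ≤ ‖x.coord i‖ * ‖y.coord i‖ * (C * (q i * r i)) := by
        have : (x * y).coord i = x.coord i * y.coord i := rfl
        rw [this, norm_mul]
        exact mul_le_mul_of_nonneg_left (h i) (by positivity)
    _ = C * (‖x.coord i‖ * q i * (‖y.coord i‖ * r i)) := by ring
    _ ≤ _ := mul_le_mul_of_nonneg_left
        (mul_le_mul_of_nonneg_left h1 (mul_nonneg (norm_nonneg _) (P.nonneg q hq i))) hC.le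

instance : IsTopologicalRing (KotheAlgebra P hP) := by
  have hz : ∀ p : P.carrier, Tendsto (seminorm P hP p) (𝓝 0) (𝓝 0) := fun p => by
    have := (withSeminorms.continuous_seminorm p).tendsto (0 : KotheAlgebra P hP)
    rwa [map_zero] at this
  refine IsTopologicalRing.of_addGroup_of_nhds_zero ?_ (fun x => ?_) (fun y => ?_) <;>
    refine (withSeminorms.tendsto_nhds _ _).mpr fun p ε hε => ?_ <;>
    obtain ⟨q, r, C, h⟩ := exists_seminorm_mul_le (hP := hP) p <;>
    simp only [sub_zero]
  · have ht := (((hz q).comp tendsto_fst).mul ((hz r).comp tendsto_snd)).const_mul C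
    rw [mul_zero, mul_zero] at ht
    filter_upwards [ht.eventually_lt_const hε] with z hz'
    exact (h _ _).trans_lt hz'
  · have ht := ((hz r).const_mul (seminorm P hP q x)).const_mul C
    rw [mul_zero, mul_zero] at ht
    filter_upwards [ht.eventually_lt_const hε] with z hz'
    exact (h _ _).trans_lt hz'
  · have ht := ((hz q).mul_const (seminorm P hP r y)).const_mul C
    rw [zero_mul, mul_zero] at ht
    filter_upwards [ht.eventually_lt_const hε] with z hz'
    exact (h _ _).trans_lt hz'

instance : T1Space (KotheAlgebra P hP) := by
  refine withSeminorms.T1_of_separating fun x hx => ?_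
  obtain ⟨i, hi⟩ : ∃ i, x.coord i ≠ 0 := by
    by_contra! h
    exact hx (Subtype.ext (funext h))
  obtain ⟨p, hp, hpi⟩ := P.exists_pos i
  refine ⟨⟨p, hp⟩, ne_of_gt ?_⟩
  exact (mul_pos (norm_pos_iff.mpr hi) hpi).trans_le (norm_coord_mul_le x ⟨p, hp⟩ i)

instance : (uniformity (KotheAlgebra P hP)).IsCountablyGenerated := by
  have : Countable P.carrier := P.countable
  have := (withSeminorms (hP := hP)).firstCountableTopology
  exact IsUniformAddGroup.uniformity_countably_generated

instance : CompleteSpace (KotheAlgebra P hP) := by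
  refine UniformSpace.complete_of_cauchySeq_tendsto fun u hu => ?_
  have hc : ∀ (p : P.carrier) (ε : ℝ), 0 < ε →
      ∃ N, ∀ n ≥ N, ∀ m ≥ N, seminorm P hP p (u n - u m) < ε := by
    intro p ε hε
    have h0 : (seminorm P hP p).ball 0 ε ∈ 𝓝 0 :=
      ((withSeminorms.mem_nhds_iff 0 _).mpr ⟨{p}, ε, hε, by simp⟩)
    have h1 := (uniformity_eq_comap_nhds_zero (KotheAlgebra P hP)).le (preimage_mem_comap h0)
    obtain ⟨N, hN⟩ := (cauchySeq_iff.mp hu) _ h1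
    refine ⟨N, fun n hn m hm => ?_⟩
    simpa [Seminorm.mem_ball] using hN m hm n hn
  have hci : ∀ i, CauchySeq fun n => (u n).coord i := by
    intro i
    obtain ⟨p, hp, hpi⟩ := P.exists_pos i
    refine Metric.cauchySeq_iff.mpr fun ε hε => ?_
    obtain ⟨N, hN⟩ := hc ⟨p, hp⟩ (ε * p i) (mul_pos hε hpi)
    refine ⟨N, fun n hn m hm => ?_⟩
    have h1 := (norm_coord_mul_le (u n - u m) ⟨p, hp⟩ i).trans_lt (hN n hn m hm)
    rw [dist_eq_norm]
    exact lt_of_mul_lt_mul_right h1 hpi.le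
  choose x hx using fun i => cauchySeq_tendsto_of_complete (hci i)
  have hfin : ∀ (p : P.carrier) (ε : ℝ), 0 < ε → ∃ N, ∀ n ≥ N, ∀ s : Finset I,
      ∑ i ∈ s, ‖(u n).coord i - x i‖ * p.1 i ≤ ε := by
    intro p ε hε
    obtain ⟨N, hN⟩ := hc p ε hε
    refine ⟨N, fun n hn s => ?_⟩
    have ht : Tendsto (fun m => ∑ i ∈ s, ‖(u n).coord i - (u m).coord i‖ * p.1 i) atTop
        (𝓝 (∑ i ∈ s, ‖(u n).coord i - x i‖ * p.1 i)) :=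
      tendsto_finsetSum _ fun i _ => ((hx i).const_sub _).norm.mul_const _
    refine le_of_tendsto ht (eventually_atTop.mpr ⟨N, fun m hm => ?_⟩)
    refine le_trans ?_ (hN n hn m hm).le
    exact (summable (u n - u m) p).sum_le_tsum s
      fun i _ => mul_nonneg (norm_nonneg _) (P.nonneg _ p.2 i)
  have hxs : x ∈ P.space := by
    intro p hp
    obtain ⟨N, hN⟩ := hfin ⟨p, hp⟩ 1 one_pos
    have h1 : Summable fun i => ‖(u N).coord i - x i‖ * p i :=
      summable_of_sum_le (fun i => mul_nonneg (norm_nonneg _) (P.nonneg _ hp i)) (hN N le_rfl)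
    refine Summable.of_nonneg_of_le (fun i => mul_nonneg (norm_nonneg _) (P.nonneg _ hp i))
      (fun i => ?_) (h1.add ((u N).summable ⟨p, hp⟩))
    rw [← add_mul]
    refine mul_le_mul_of_nonneg_right ?_ (P.nonneg _ hp i)
    rw [← norm_neg ((u N).coord i - x i), neg_sub]
    exact norm_le_norm_sub_add _ _
  let y : KotheAlgebra P hP := ⟨x, hxs⟩
  refine ⟨y, ?_⟩
  refine (withSeminorms.tendsto_nhds _ _).mpr fun p ε hε => ?_
  obtain ⟨N, hN⟩ := hfin p (ε / 2) (half_pos hε)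
  refine eventually_atTop.mpr ⟨N, fun n hn => lt_of_le_of_lt ?_ (half_lt_self hε)⟩
  exact (summable (u n - y) p).tsum_le_of_sum_le (hN n hn)

/-- `λ(P)` is a Fréchet algebra. -/
instance : IsFrechetAlgebra (KotheAlgebra P hP) where
  toContinuousSMul := withSeminorms.continuousSMul
  toLocallyConvexSpace := withSeminorms.toLocallyConvexSpace
  toMetrizableSpace := UniformSpace.metrizableSpace
  complete := CompleteSpace.complete
  continuous_mul := continuous_mul

end KotheAlgebra

/-! For a finite set `F` let e be its indicator, an idempotent of the algebra. On a finite sum of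
unit vectors a derivation can be averaged explicitly, and this gives an element x of the bimodule
(`implement`) whose inner derivation is a ↦ e·Da + Da·e − e·Da·e. The error D − ad x is therefore (1
− e)·Da·(1 − e), with 1 a formal unit.

This error need not be small for an arbitrary choice of `F`, because the size of e may grow. If a =
bc, however, the Leibniz rule splits it into (b − be)·Dc·(1 − e) and (1 − e)·Db·(c − ce). It then
suffices that both ‖b − be‖ and ‖b − be‖‖e‖ are small, and likewise for c. Every element does factor
(`exists_eq_mul`): take b = √|a|, which lies in the algebra by (N) and P² ≺ P.

The heart is `exists_idem_approx`, which finds `F` with both quantities small. With p ≤ αq from (N),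
keep in `F` only indices with q ≤ t. Then ‖e‖_p ≤ t‖α‖₁. An index dropped because q > t costs at
most |b|·p·t ≤ |b|·p·q, which (B) bounds by a multiple of |b|·r for some r in P; this is the term of
a convergent series. -/

theorem isDirectedOrder_prod {α β : Type*} [Preorder α] [Preorder β] [IsDirectedOrder α]
    [IsDirectedOrder β] : IsDirectedOrder (α × β) :=
  ⟨fun x y =>
    let ⟨a, hxa, hya⟩ := exists_ge_ge x.1 y.1
    let ⟨b, hxb, hyb⟩ := exists_ge_ge x.2 y.2
    ⟨(a, b), ⟨hxa, hxb⟩, ⟨hya, hyb⟩⟩⟩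

instance KotheSet.isDirectedOrder_carrier {I : Type u} (P : KotheSet I) :
    IsDirectedOrder P.carrier :=
  ⟨fun p q =>
    let ⟨r, hr, h⟩ := P.directed p.1 p.2 q.1 q.2
    ⟨⟨r, hr⟩, fun i => (le_max_left _ _).trans (h i), fun i => (le_max_right _ _).trans (h i)⟩⟩

/-! ### Unit vectors and finite idempotents -/

namespace KotheAlgebra

variable {I : Type u} {P : KotheSet I} {hP : P.Dominated (P.prod P)}

theorem ext_coord {x y : KotheAlgebra P hP} (h : ∀ i, x.coord i = y.coord i) : x = y :=
  Subtype.ext (funext h)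

theorem coord_mul (x y : KotheAlgebra P hP) (i : I) :
    (x * y).coord i = x.coord i * y.coord i := rfl

theorem coord_sub (x y : KotheAlgebra P hP) (i : I) :
    (x - y).coord i = x.coord i - y.coord i := rfl

theorem coord_smul (c : ℂ) (x : KotheAlgebra P hP) (i : I) :
    (c • x).coord i = c * x.coord i := rfl

theorem seminorm_apply (p : P.carrier) (x : KotheAlgebra P hP) :
    seminorm P hP p x = ∑' i, ‖x.coord i‖ * p.1 i := rfl

/-- The indicator function of a finite set, an idempotent of `λ(P)`. -/
noncomputable def idem (P : KotheSet I) (hP : P.Dominated (P.prod P)) (F : Finset I) :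
    KotheAlgebra P hP :=
  ⟨Set.indicator (F : Set I) 1, fun p _ =>
    summable_of_ne_finset_zero (s := F) fun i hi => by simp [hi]⟩

theorem coord_idem (F : Finset I) (i : I) :
    (idem P hP F).coord i = Set.indicator (F : Set I) 1 i := rfl

theorem coord_idem_of_mem {F : Finset I} {i : I} (hi : i ∈ F) :
    (idem P hP F).coord i = 1 := by simp [coord_idem, hi]

theorem coord_idem_of_notMem {F : Finset I} {i : I} (hi : i ∉ F) :
    (idem P hP F).coord i = 0 := by simp [coord_idem, hi]

/-- The standard unit vectors of `λ(P)`. -/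
noncomputable def unitVec (P : KotheSet I) (hP : P.Dominated (P.prod P)) (i : I) :
    KotheAlgebra P hP := idem P hP {i}

theorem mul_unitVec (a : KotheAlgebra P hP) (i : I) :
    a * unitVec P hP i = a.coord i • unitVec P hP i := by
  refine ext_coord fun j => ?_
  rw [coord_mul, coord_smul, unitVec]
  by_cases h : j = i
  · rw [h]
  · rw [coord_idem_of_notMem (by simpa using h), mul_zero, mul_zero]

theorem coord_sum (F : Finset I) (f : I → KotheAlgebra P hP) (j : I) :
    (∑ i ∈ F, f i).coord j = ∑ i ∈ F, (f i).coord j := by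
  classical
  induction F using Finset.induction_on with
  | empty => rfl
  | insert i s hi ih =>
    rw [Finset.sum_insert hi, Finset.sum_insert hi, ← ih]
    rfl

theorem sum_unitVec (F : Finset I) : ∑ i ∈ F, unitVec P hP i = idem P hP F := by
  classical
  refine ext_coord fun j => ?_
  rw [coord_sum, coord_idem]
  simp [unitVec, coord_idem, Set.indicator_apply]

theorem seminorm_idem (p : P.carrier) (F : Finset I) :
    seminorm P hP p (idem P hP F) = ∑ i ∈ F, p.1 i := by
  rw [seminorm_apply, tsum_eq_sum (s := F) fun i hi => by simp [coord_idem_of_notMem hi]]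
  exact Finset.sum_congr rfl fun i hi => by simp [coord_idem_of_mem hi]

theorem seminorm_mono {p q : P.carrier} (h : p.1 ≤ q.1) (x : KotheAlgebra P hP) :
    seminorm P hP p x ≤ seminorm P hP q x :=
  (summable x p).tsum_le_tsum (fun i => mul_le_mul_of_nonneg_left (h i) (norm_nonneg _))
    (summable x q)

theorem seminorm_sub_mul_idem_le [DecidableEq I] (p : P.carrier) (b : KotheAlgebra P hP)
    (F : Finset I) {c : ℝ} (h : ∀ s : Finset I, ∑ i ∈ s \ F, ‖b.coord i‖ * p.1 i ≤ c) :
    seminorm P hP p (b - b * idem P hP F) ≤ c := by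
  refine (summable _ p).tsum_le_of_sum_le fun s => le_trans (le_of_eq ?_) (h s)
  rw [← Finset.filter_notMem_eq_sdiff, Finset.sum_filter]
  refine Finset.sum_congr rfl fun i _ => ?_
  rw [coord_sub, coord_mul]
  by_cases hi : i ∈ F
  · simp [coord_idem_of_mem hi, hi]
  · simp [coord_idem_of_notMem hi, hi]

/-! ### Approximation by idempotents of controlled size, and factorization -/

/-- The idempotents `idem F` approximate finitely many elements of `λ(P)` so well that the errors
stay small after multiplication by the size of `idem F`. -/
theorem exists_idem_approx (hB : P.CondB) (hN : P.CondN) (B : Finset (KotheAlgebra P hP))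
    (p : P.carrier) {ε : ℝ} (hε : 0 < ε) : ∃ F : Finset I, ∀ b ∈ B,
      seminorm P hP p (b - b * idem P hP F) ≤ ε ∧
      seminorm P hP p (b - b * idem P hP F) * seminorm P hP p (idem P hP F) ≤ ε := by
  classical
  obtain ⟨q, hq, α, hα, hpα⟩ := hN p.1 p.2
  obtain ⟨r, hr, C, hC, hpr⟩ := hB.2 _ ⟨p.1, p.2, q, hq, rfl⟩
  have hp0 := P.nonneg p.1 p.2
  have hq0 := P.nonneg q hq
  have hr0 := P.nonneg r hr
  set K : ℝ := ∑' i, ‖α i‖ with hK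
  have hK0 : 0 ≤ K := tsum_nonneg fun i => norm_nonneg _
  have hpα' : ∀ i, p.1 i ≤ ‖α i‖ * q i := fun i =>
    (hpα i).trans (mul_le_mul_of_nonneg_right (le_abs_self _) (hq0 i))
  -- The weight `w` dominates every `b ∈ B`, so that one `F` serves all of them.
  set w : I → ℝ := fun i => ∑ b ∈ B, ‖b.coord i‖ with hw
  have hw0 : ∀ i, 0 ≤ w i := fun i => Finset.sum_nonneg fun b _ => norm_nonneg _
  have hws : ∀ s ∈ P.carrier, Summable fun i => w i * s i := by
    intro s hs
    simp only [hw, Finset.sum_mul]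
    exact summable_sum fun b _ => b.summable ⟨s, hs⟩
  have hbw : ∀ b ∈ B, ∀ i, ‖b.coord i‖ ≤ w i := fun b hb i =>
    Finset.single_le_sum (f := fun b : KotheAlgebra P hP => ‖b.coord i‖)
      (fun _ _ => norm_nonneg _) hb
  have tail : ∀ s ∈ P.carrier, ∀ η : ℝ, 0 < η → ∃ G : Finset I, ∀ t : Finset I,
      Disjoint t G → ∑ i ∈ t, w i * s i ≤ η := by
    intro s hs η hη
    obtain ⟨G, hG⟩ := summable_iff_vanishing_norm.mp (hws s hs) η hη
    exact ⟨G, fun t ht => (le_abs_self _).trans (hG t ht).le⟩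
  -- The order of choices matters: `G` is fixed before `t`, and the far cutoff `H` after it, since
  -- its tolerance depends on `t`. The `+ 1` keeps the denominators positive.
  obtain ⟨G₁, hG₁⟩ := tail r hr (ε / 2 / (C * K + 1)) (by positivity)
  obtain ⟨G₂, hG₂⟩ := tail p.1 p.2 ε hε
  set G := G₁ ∪ G₂ with hG
  -- Any `t` bounding `q` on `G` would do; it makes the truncation at level `t` keep all of `G`.
  set t : ℝ := ∑ i ∈ G, q i with ht
  have ht0 : 0 ≤ t := Finset.sum_nonneg fun i _ => hq0 i
  obtain ⟨H', hH'⟩ := tail p.1 p.2 (ε / 2 / (t * K + 1)) (by positivity)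
  set H := H' ∪ G with hH
  set F := H.filter fun i => q i ≤ t with hF
  have hGF : G ⊆ F := fun i hi => Finset.mem_filter.mpr
    ⟨Finset.mem_union_right _ hi, Finset.single_le_sum (fun j _ => hq0 j) hi⟩
  have hT : ∑ j ∈ F, p.1 j ≤ t * K := by
    calc ∑ j ∈ F, p.1 j ≤ ∑ j ∈ F, t * ‖α j‖ := Finset.sum_le_sum fun j hj => by
          rw [mul_comm]
          exact (hpα' j).trans
            (mul_le_mul_of_nonneg_left (Finset.mem_filter.mp hj).2 (norm_nonneg _))
      _ = t * ∑ j ∈ F, ‖α j‖ := (Finset.mul_sum _ _ _).symm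
      _ ≤ t * K := mul_le_mul_of_nonneg_left
          (hα.norm.sum_le_tsum F fun i _ => norm_nonneg _) ht0
  have hT0 : 0 ≤ ∑ j ∈ F, p.1 j := Finset.sum_nonneg fun j _ => hp0 j
  refine ⟨F, fun b hb => ⟨seminorm_sub_mul_idem_le p b F fun s => ?_, ?_⟩⟩
  · refine (Finset.sum_le_sum fun i _ =>
      mul_le_mul_of_nonneg_right (hbw b hb i) (hp0 i)).trans (hG₂ _ ?_)
    exact Finset.disjoint_of_subset_right
      (Finset.subset_union_right.trans hGF) Finset.sdiff_disjoint
  rw [seminorm_idem]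
  -- The second estimate is proved after division by the size of the idempotent, so size zero is set
  -- apart.
  rcases hT0.eq_or_lt with h0 | hTpos
  · rw [← h0, mul_zero]; exact hε.le
  rw [← le_div_iff₀ hTpos]
  refine seminorm_sub_mul_idem_le p b F fun s => ?_
  rw [le_div_iff₀ hTpos, Finset.sum_mul]
  set f : I → ℝ := fun i => w i * p.1 i * (t * K) with hf
  set g : I → ℝ := fun i => C * K * (w i * r i) with hg
  have hf0 : ∀ i, 0 ≤ f i := fun i =>
    mul_nonneg (mul_nonneg (hw0 i) (hp0 i)) (mul_nonneg ht0 hK0)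
  have hg0 : ∀ i, 0 ≤ g i := fun i =>
    mul_nonneg (mul_nonneg hC.le hK0) (mul_nonneg (hw0 i) (hr0 i))
  have hfs : ∑ i ∈ s \ H, f i ≤ ε / 2 := by
    have h1 := hH' (s \ H) (Finset.disjoint_of_subset_right Finset.subset_union_left
      Finset.sdiff_disjoint)
    rw [le_div_iff₀ (by positivity)] at h1
    rw [hf, ← Finset.sum_mul]
    refine le_trans ?_ h1
    exact mul_le_mul_of_nonneg_left (by linarith)
      (Finset.sum_nonneg fun i _ => mul_nonneg (hw0 i) (hp0 i))
  have hgs : ∑ i ∈ s \ G, g i ≤ ε / 2 := by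
    have h1 := hG₁ (s \ G) (Finset.disjoint_of_subset_right Finset.subset_union_left
      Finset.sdiff_disjoint)
    rw [le_div_iff₀ (by positivity), mul_comm] at h1
    rw [hg, ← Finset.mul_sum]
    refine le_trans ?_ h1
    exact mul_le_mul_of_nonneg_right (by linarith)
      (Finset.sum_nonneg fun i _ => mul_nonneg (hw0 i) (hr0 i))
  -- An index outside `F` is either outside `H`, where the tail beats the fixed factor `t * K`, or
  -- was removed by the truncation. In the latter case `t ≤ q i`, and `t` is traded for `q i`, then
  -- `p * q` for `C * r`.
  have hterm : ∀ i ∈ s \ F, ‖b.coord i‖ * p.1 i * ∑ j ∈ F, p.1 j ≤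
      (if i ∈ s \ H then f i else 0) + if i ∈ s \ G then g i else 0 := by
    intro i hi
    obtain ⟨his, hiF⟩ := Finset.mem_sdiff.mp hi
    have hiG : i ∈ s \ G := Finset.mem_sdiff.mpr ⟨his, fun h => hiF (hGF h)⟩
    have h1 : ‖b.coord i‖ * p.1 i * ∑ j ∈ F, p.1 j ≤ f i :=
      mul_le_mul (mul_le_mul_of_nonneg_right (hbw b hb i) (hp0 i)) hT hT0
        (mul_nonneg (hw0 i) (hp0 i))
    rw [if_pos hiG]
    by_cases hiH : i ∈ s \ H
    · rw [if_pos hiH]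
      linarith [hg0 i]
    · rw [if_neg hiH, zero_add]
      have hqt : t ≤ q i := by
        by_contra! h
        refine hiH (Finset.mem_sdiff.mpr ⟨his, fun h' => hiF ?_⟩)
        exact Finset.mem_filter.mpr ⟨h', h.le⟩
      calc _ ≤ f i := h1
        _ ≤ w i * p.1 i * (q i * K) := mul_le_mul_of_nonneg_left
            (mul_le_mul_of_nonneg_right hqt hK0) (mul_nonneg (hw0 i) (hp0 i))
        _ = w i * K * (p.1 i * q i) := by ring
        _ ≤ w i * K * (C * r i) := mul_le_mul_of_nonneg_left (hpr i) (mul_nonneg (hw0 i) hK0)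
        _ = g i := by rw [hg]; ring
  refine (Finset.sum_le_sum hterm).trans ?_
  rw [Finset.sum_add_distrib]
  have hsub : ∀ {E : Finset I} (k : I → ℝ), (∀ i, 0 ≤ k i) →
      ∑ i ∈ s \ F, (if i ∈ s \ E then k i else 0) ≤ ∑ i ∈ s \ E, k i := by
    intro E k hk
    rw [← Finset.sum_filter]
    exact Finset.sum_le_sum_of_subset_of_nonneg (fun i hi => (Finset.mem_filter.mp hi).2)
      fun i _ _ => hk i
  linarith [hsub (E := H) f hf0, hsub (E := G) g hg0]

/-- Every element of a nuclear Köthe algebra with `P² ≺ P` is a product. -/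
theorem exists_eq_mul (hB : P.CondB) (hN : P.CondN) (a : KotheAlgebra P hP) :
    ∃ b c : KotheAlgebra P hP, a = b * c := by
  -- Since q² ≤ Cr, the numbers √|aᵢ|·qᵢ are bounded by √(C‖a‖_r); the factor α from (N) turns
  -- boundedness into summability.
  have hs : ∀ p ∈ P.carrier, Summable fun i => √‖a.coord i‖ * p i := by
    intro p hp
    obtain ⟨q, hq, α, hα, hpα⟩ := hN p hp
    obtain ⟨r, hr, C, hC, hqr⟩ := hB.2 _ ⟨q, hq, q, hq, rfl⟩
    refine Summable.of_nonneg_of_le (fun i => mul_nonneg (Real.sqrt_nonneg _) (P.nonneg p hp i))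
      (fun i => ?_) (hα.norm.mul_right √(C * seminorm P hP ⟨r, hr⟩ a))
    have h1 := norm_coord_mul_le a ⟨r, hr⟩ i
    have h2 : √‖a.coord i‖ * q i ≤ √(C * seminorm P hP ⟨r, hr⟩ a) := by
      refine Real.le_sqrt_of_sq_le ?_
      rw [mul_pow, Real.sq_sqrt (norm_nonneg _)]
      calc ‖a.coord i‖ * q i ^ 2 ≤ ‖a.coord i‖ * (C * r i) := by
            rw [sq]
            exact mul_le_mul_of_nonneg_left (hqr i) (norm_nonneg _)
        _ = C * (‖a.coord i‖ * r i) := by ring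
        _ ≤ _ := mul_le_mul_of_nonneg_left h1 hC.le
    calc √‖a.coord i‖ * p i ≤ √‖a.coord i‖ * (‖α i‖ * q i) :=
          mul_le_mul_of_nonneg_left ((hpα i).trans (mul_le_mul_of_nonneg_right (le_abs_self _)
            (P.nonneg q hq i))) (Real.sqrt_nonneg _)
      _ = ‖α i‖ * (√‖a.coord i‖ * q i) := by ring
      _ ≤ _ := mul_le_mul_of_nonneg_left h2 (norm_nonneg _)
  -- Both factors have modulus √|aᵢ| at every index, also where aᵢ = 0 because there 0 / 0 = 0, so
  -- `hs` serves for both.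
  refine ⟨⟨fun i => (√‖a.coord i‖ : ℂ), fun p hp => ?_⟩,
    ⟨fun i => a.coord i / (√‖a.coord i‖ : ℂ), fun p hp => ?_⟩, ext_coord fun i => ?_⟩
  · simpa [abs_of_nonneg (Real.sqrt_nonneg _)] using hs p hp
  · simpa [abs_of_nonneg (Real.sqrt_nonneg _)] using hs p hp
  · change a.coord i = (√‖a.coord i‖ : ℂ) * (a.coord i / (√‖a.coord i‖ : ℂ))
    by_cases h : a.coord i = 0
    · simp [h]
    · have : (√‖a.coord i‖ : ℂ) ≠ 0 := by
        simpa [Real.sqrt_eq_zero'] using h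
      field_simp

/-! ### Continuity in terms of a single seminorm -/

/-- As `P` is directed, the finitely many seminorms defining a neighbourhood are dominated by one.
-/
theorem exists_seminorm_lt_imp_mem [Nonempty P.carrier] {U : Set (KotheAlgebra P hP)}
    (hU : U ∈ 𝓝 0) :
    ∃ (p : P.carrier) (ε : ℝ), 0 < ε ∧ ∀ x, seminorm P hP p x < ε → x ∈ U := by
  obtain ⟨s, ε, hε, hs⟩ := (withSeminorms.mem_nhds_iff 0 U).mp hU
  obtain ⟨q, hq⟩ := s.exists_le
  refine ⟨q, ε, hε, fun x hx => hs ?_⟩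
  rw [Seminorm.mem_ball, sub_zero]
  exact Seminorm.finset_sup_apply_lt hε fun p hp => (seminorm_mono (hq p hp) x).trans_lt hx

variable {X : Type v} [AddCommGroup X] [Module ℂ X] [UniformSpace X]

theorem exists_seminorm_le_imp_map_mem [Nonempty P.carrier] {f : KotheAlgebra P hP →ₗ[ℂ] X}
    (hf : Continuous f) {U : Set X} (hU : U ∈ 𝓝 0) :
    ∃ (p : P.carrier) (ε : ℝ), 0 < ε ∧ ∀ x, seminorm P hP p x ≤ ε → f x ∈ U := by
  obtain ⟨p, ε, hε, h⟩ := exists_seminorm_lt_imp_mem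
    (hf.continuousAt.preimage_mem_nhds (by rwa [map_zero]) : f ⁻¹' U ∈ 𝓝 0)
  exact ⟨p, ε / 2, half_pos hε, fun x hx => h x (hx.trans_lt (half_lt_self hε))⟩

/-- Joint continuity controls the values when both arguments are small. Replacing (x, y) by (s x,
s⁻¹ y) does not change the value, so a small product of seminorms is enough, even when one factor is
large. -/
theorem exists_seminorm_mul_le_imp_map_mem [Nonempty P.carrier]
    {f : KotheAlgebra P hP →ₗ[ℂ] KotheAlgebra P hP →ₗ[ℂ] X}
    (hf : Continuous fun z : KotheAlgebra P hP × KotheAlgebra P hP => f z.1 z.2)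
    {U : Set X} (hU : U ∈ 𝓝 0) : ∃ (p : P.carrier) (ε : ℝ), 0 < ε ∧
      ∀ x y, seminorm P hP p x * seminorm P hP p y ≤ ε → f x y ∈ U := by
  have hpre : (fun z : KotheAlgebra P hP × KotheAlgebra P hP => f z.1 z.2) ⁻¹' U ∈ 𝓝 (0, 0) :=
    hf.continuousAt.preimage_mem_nhds (by simpa using hU)
  rw [nhds_prod_eq] at hpre
  obtain ⟨V, hV, hVU⟩ := mem_prod_same_iff.mp hpre
  obtain ⟨p, ε, hε, h⟩ := exists_seminorm_lt_imp_mem hV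
  refine ⟨p, ε ^ 2 / 2, by positivity, fun x y hxy => ?_⟩
  obtain ⟨s, hs, hsx, hsy⟩ : ∃ s : ℝ, 0 < s ∧ s * seminorm P hP p x < ε ∧
      s⁻¹ * seminorm P hP p y < ε := by
    have hx0 := apply_nonneg (seminorm P hP p) x
    have hy0 := apply_nonneg (seminorm P hP p) y
    -- If ‖x‖ = 0, any large s works. Otherwise s is chosen so that ‖s x‖ = 3ε/4, whence ‖s⁻¹ y‖ ≤
    -- (ε²/2)/(3ε/4) = 2ε/3.
    rcases hx0.eq_or_lt with hx | hx
    · refine ⟨(seminorm P hP p y + 1) / ε, by positivity, by rw [← hx, mul_zero]; exact hε, ?_⟩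
      rw [inv_div, div_mul_eq_mul_div, div_lt_iff₀ (by positivity)]
      exact mul_lt_mul_of_pos_left (by linarith) hε
    · refine ⟨3 / 4 * ε / seminorm P hP p x, by positivity, ?_, ?_⟩
      · rw [div_mul_cancel₀ _ hx.ne']
        linarith
      · rw [inv_div, div_mul_eq_mul_div, div_lt_iff₀ (by positivity)]
        nlinarith [sq_pos_of_pos hε]
  have key : f ((s : ℂ) • x) ((s : ℂ)⁻¹ • y) = f x y := by
    rw [map_smul, map_smul, LinearMap.smul_apply, smul_smul, inv_mul_cancel₀, one_smul]
    exact_mod_cast hs.ne'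
  rw [← key]
  refine hVU (Set.mk_mem_prod (h _ ?_) (h _ ?_))
  · rw [map_smul_eq_mul, Complex.norm_real, Real.norm_of_nonneg hs.le]
    exact hsx
  · rw [map_smul_eq_mul, norm_inv, Complex.norm_real, Real.norm_of_nonneg hs.le]
    exact hsy

end KotheAlgebra

/-! ### Inner derivations that implement the compressions -/

namespace FrechetBimodule

open KotheAlgebra

variable {I : Type u} {P : KotheSet I} {hP : P.Dominated (P.prod P)}
variable {X : Type v} [AddCommGroup X] [Module ℂ X] [UniformSpace X]
variable (M : FrechetBimodule (KotheAlgebra P hP) X) {D : KotheAlgebra P hP →ₗ[ℂ] X}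

/-- The inner derivation defined by `x`. -/
def innerDerivation (x : X) : KotheAlgebra P hP →ₗ[ℂ] X := M.left.flip x - M.right.flip x

theorem innerDerivation_apply (x : X) (a : KotheAlgebra P hP) :
    M.innerDerivation x a = M.left a x - M.right a x := rfl

/-- The element of `X` that implements the compression
`a ↦ e · D a + D a · e - e · D a · e` of a derivation `D`, where `e = idem F`. -/
noncomputable def implement (D : KotheAlgebra P hP →ₗ[ℂ] X) (F : Finset I) : X :=
  ∑ i ∈ F, (M.left (unitVec P hP i) (D (unitVec P hP i))
    - M.right (unitVec P hP i) (D (unitVec P hP i))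
    + M.left (idem P hP F) (M.right (unitVec P hP i) (D (unitVec P hP i))))

variable {M}

/-- Compare two expressions for D(a eᵢ): the Leibniz rule, and linearity with a eᵢ = aᵢ eᵢ. -/
theorem IsDerivation.left_map_unitVec (hD : M.IsDerivation D) (a : KotheAlgebra P hP) (i : I) :
    M.left a (D (unitVec P hP i)) =
      a.coord i • D (unitVec P hP i) - M.right (unitVec P hP i) (D a) := by
  rw [← map_smul, ← mul_unitVec, hD, add_sub_cancel_right]

theorem IsDerivation.right_map_unitVec (hD : M.IsDerivation D) (a : KotheAlgebra P hP) (i : I) :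
    M.right a (D (unitVec P hP i)) =
      a.coord i • D (unitVec P hP i) - M.left (unitVec P hP i) (D a) := by
  rw [← map_smul, ← mul_unitVec, mul_comm, hD, add_sub_cancel_left]

theorem IsDerivation.innerDerivation_implement (hD : M.IsDerivation D) (F : Finset I)
    (a : KotheAlgebra P hP) :
    M.innerDerivation (M.implement D F) a =
      M.left (idem P hP F) (D a) + M.right (idem P hP F) (D a)
        - M.left (idem P hP F) (M.right (idem P hP F) (D a)) := by
  -- In the commutator with a, the terms containing aᵢ cancel: eᵢ·Deᵢ yields eᵢ·Da, and Deᵢ·eᵢ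
  -- yields −Da·eᵢ. Since a commutes with e, the third summand yields −e·Da·eᵢ. Summation over `F`
  -- turns eᵢ into e.
  have hterm : ∀ i, M.innerDerivation (M.left (unitVec P hP i) (D (unitVec P hP i))
      - M.right (unitVec P hP i) (D (unitVec P hP i))
      + M.left (idem P hP F) (M.right (unitVec P hP i) (D (unitVec P hP i)))) a =
      M.left (unitVec P hP i) (D a) + M.right (unitVec P hP i) (D a)
        - M.left (idem P hP F) (M.right (unitVec P hP i) (D a)) := by
    intro i
    set e := unitVec P hP i with he
    set E := idem P hP F
    have hee : e * e = e := by
      refine ext_coord fun j => ?_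
      rw [coord_mul, he, unitVec, coord_idem]
      by_cases h : j = i <;> simp [h]
    have hl : ∀ z, M.left a (M.left e z) = a.coord i • M.left e z := fun z => by
      rw [← M.left_mul, mul_unitVec, map_smul, LinearMap.smul_apply]
    have hr : ∀ z, M.right a (M.right e z) = a.coord i • M.right e z := fun z => by
      rw [← M.right_mul, mul_comm, mul_unitVec, map_smul, LinearMap.smul_apply]
    have hle : M.left e (M.left e (D a)) = M.left e (D a) := by rw [← M.left_mul, hee]
    have hre : M.right e (M.right e (D a)) = M.right e (D a) := by rw [← M.right_mul, hee]
    have hlE : ∀ z, M.left a (M.left E z) = M.left E (M.left a z) := fun z => by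
      rw [← M.left_mul, mul_comm, M.left_mul]
    have hlr : M.left a (M.right e (D e)) = a.coord i • M.right e (D e) - M.right e (D a) := by
      rw [← M.left_right, hD.left_map_unitVec, map_sub, map_smul, hre]
    have hrl : M.right a (M.left e (D e)) = a.coord i • M.left e (D e) - M.left e (D a) := by
      rw [M.left_right, hD.right_map_unitVec, map_sub, map_smul, hle]
    simp only [innerDerivation_apply, map_add, map_sub, hl, hlE, hr, hlr, hrl,
      M.left_right E a, map_smul]
    abel
  rw [implement, innerDerivation, LinearMap.sub_apply, LinearMap.flip_apply, LinearMap.flip_apply,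
    map_sum, map_sum, ← Finset.sum_sub_distrib]
  refine (Finset.sum_congr rfl fun i _ => hterm i).trans ?_
  rw [Finset.sum_sub_distrib, Finset.sum_add_distrib]
  simp only [← sum_unitVec F, map_sum, LinearMap.sum_apply]

/-- This is (1 − e)·D(bc)·(1 − e) expanded by the Leibniz rule. Each term applies b − be or c − ce
to a vector independent of `F`, with at most one further factor e. -/
theorem IsDerivation.map_mul_sub_innerDerivation_implement (hD : M.IsDerivation D) (F : Finset I)
    (b c : KotheAlgebra P hP) :
    D (b * c) - M.innerDerivation (M.implement D F) (b * c) =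
      M.left (b - b * idem P hP F) (D c)
        - M.right (idem P hP F) (M.left (b - b * idem P hP F) (D c))
        + (M.right (c - c * idem P hP F) (D b)
          - M.left (idem P hP F) (M.right (c - c * idem P hP F) (D b))) := by
  set E := idem P hP F
  rw [hD.innerDerivation_implement, hD, mul_comm b E]
  simp only [map_add, map_sub, LinearMap.sub_apply, M.left_mul, M.right_mul, M.left_right]
  abel

end FrechetBimodule

/-! ### The approximating net -/

open KotheAlgebra in
theorem theorem7p1 {I : Type u} (P : KotheSet I) (hP : P.Dominated (P.prod P))
    (hB : P.CondB) (hN : P.CondN) :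
    IsApproximatelyContractible.{u, v} (KotheAlgebra P hP) := by
  intro X _ _ _ _ M D hDc hD
  -- For empty `I` the Köthe set itself may be empty, and then no seminorm is available.
  rcases isEmpty_or_nonempty I with hI | ⟨⟨i₀⟩⟩
  · refine ⟨PUnit, inferInstance, inferInstance, inferInstance, fun _ => 0,
      fun _ => ⟨0, by simp⟩, fun a => ?_⟩
    have : a = 0 := ext_coord fun i => hI.elim i
    simp [this]
  have : Nonempty P.carrier := let ⟨p, hp, _⟩ := P.exists_pos i₀; ⟨⟨p, hp⟩⟩
  -- A net index prescribes a finite set of elements, a seminorm and a tolerance 1/(n + 1).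
  choose F hF using fun l : Finset (KotheAlgebra P hP) × P.carrier × ℕ =>
    exists_idem_approx hB hN l.1 l.2.1 (Nat.one_div_pos_of_nat (α := ℝ) (n := l.2.2))
  refine ⟨Finset (KotheAlgebra P hP) × P.carrier × ℕ, inferInstance, ?_, inferInstance,
    fun l => M.innerDerivation (M.implement D (F l)), fun l => ⟨_, fun _ => rfl⟩, fun a => ?_⟩
  · have := isDirectedOrder_prod (α := P.carrier) (β := ℕ)
    exact isDirectedOrder_prod
  obtain ⟨b, c, rfl⟩ := exists_eq_mul hB hN a
  have hsmall : ∀ (p : P.carrier) (ε : ℝ) (b : KotheAlgebra P hP), 0 < ε →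
      ∀ᶠ l in atTop, seminorm P hP p (b - b * idem P hP (F l)) ≤ ε ∧
        seminorm P hP p (b - b * idem P hP (F l)) * seminorm P hP p (idem P hP (F l)) ≤ ε := by
    intro p ε b hε
    obtain ⟨n, hn⟩ := exists_nat_one_div_lt hε
    filter_upwards [eventually_ge_atTop (({b}, p, n) :
      Finset (KotheAlgebra P hP) × P.carrier × ℕ)] with l hl
    obtain ⟨h1, h2⟩ := hF l b (hl.1 (Finset.mem_singleton_self b))
    have hp : p.1 ≤ l.2.1.1 := hl.2.1
    have hle : 1 / ((l.2.2 : ℝ) + 1) ≤ ε :=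
      (Nat.one_div_le_one_div hl.2.2).trans hn.le
    refine ⟨(seminorm_mono hp _).trans (h1.trans hle), le_trans ?_ (h2.trans hle)⟩
    exact mul_le_mul (seminorm_mono hp _) (seminorm_mono hp _) (apply_nonneg _ _)
      (apply_nonneg _ _)
  have hlin : ∀ (f : KotheAlgebra P hP →ₗ[ℂ] X) (b : KotheAlgebra P hP), Continuous f →
      Tendsto (fun l => f (b - b * idem P hP (F l))) atTop (𝓝 0) := by
    intro f b hf U hU
    obtain ⟨p, ε, hε, h⟩ := exists_seminorm_le_imp_map_mem hf hU
    exact (hsmall p ε b hε).mono fun l hl => h _ hl.1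
  have hbilin : ∀ (f : KotheAlgebra P hP →ₗ[ℂ] KotheAlgebra P hP →ₗ[ℂ] X)
      (b : KotheAlgebra P hP),
      (Continuous fun z : KotheAlgebra P hP × KotheAlgebra P hP => f z.1 z.2) →
      Tendsto (fun l => f (b - b * idem P hP (F l)) (idem P hP (F l))) atTop (𝓝 0) := by
    intro f b hf U hU
    obtain ⟨p, ε, hε, h⟩ := exists_seminorm_mul_le_imp_map_mem hf hU
    exact (hsmall p ε b hε).mono fun l hl => h _ _ hl.2
  have hcl : ∀ z, Continuous fun a => M.left a z := fun z =>
    M.continuous_left.comp (continuous_id.prodMk continuous_const)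
  have hcr : ∀ z, Continuous fun a => M.right a z := fun z =>
    M.continuous_right.comp (continuous_id.prodMk continuous_const)
  -- The four terms of the error: those with a single factor tend to 0 by the first estimate, those
  -- carrying an extra e by the product estimate.
  have hlim := ((hlin (M.left.flip (D c)) b (hcl _)).sub
    (hbilin ((M.right.flip ∘ₗ M.left.flip (D c))) b
      (M.continuous_right.comp (continuous_snd.prodMk ((hcl (D c)).comp continuous_fst))))).add
    ((hlin (M.right.flip (D b)) c (hcr _)).sub
    (hbilin ((M.left.flip ∘ₗ M.right.flip (D b))) c
      (M.continuous_left.comp (continuous_snd.prodMk ((hcr (D b)).comp continuous_fst)))))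
  have hlim' := hlim.const_sub (D (b * c))
  simp only [sub_zero, add_zero] at hlim'
  refine hlim'.congr fun l => ?_
  rw [sub_eq_iff_eq_add, ← sub_eq_iff_eq_add']
  exact hD.map_mul_sub_innerDerivation_implement (F l) b c
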